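/- For $Y, Z \subseteq \omega$ write $Y \subseteq^* Z$ if $Y \setminus Z$ is finite. A *tower* is a set $\mathcal T$ of infinite subsets of $\omega$ that is reverse well-ordered by $\subseteq^*$ (its elements are pairwise distinct modulo finite sets). A *pseudointersection* of $\mathcal T$ is an infinite $Z \subseteq \omega$ with $Z \subseteq^* Y$ for every $Y \in \mathcal T$. A set $A \subseteq \mathbb R$ is *$\aleph_1$-dense* if $|A \cap I| = \aleph_1$ for every nonempty open interval $I$. Let $A, B \subseteq \mathbb R$ be $\aleph_1$-dense. A nonempty partial order $\mathbb P$ is *reasonable* for $A$ and $B$ if: 1. every condition $p \in \mathbb P$ is a finite partial isomorphism from $A$ to $B$, i.e. a strictly increasing function from a finite subset of $A$ into $B$, and $q \le p$ holds iff $q$ extends $p$ as a function; 2. if $p \in \mathbb P$ and $Z \subseteq \operatorname{dom}(p)$, then $p \restriction Z \in \mathbb P$; 3. if $p \in \mathbb P$ and $x \in A \setminus \operatorname{dom}(p)$, and if $x_0$ is the largest element of $\operatorname{dom}(p) \cup \{-\infty\}$ below $x$ and $x_1$ is the smallest element of $\operatorname{dom}(p) \cup \{+\infty\}$ above $x$,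 then for every nonempty open interval $U \subseteq (p(x_0), p(x_1))$ there is $q \le p$ in $\mathbb P$ with $x \in \operatorname{dom}(q)$ and $q(x) \in U$; here $p(\pm\infty) = \pm\infty$. **Theorem.** For every tower $\mathcal T$ of size $\aleph_1$ there are $\aleph_1$-dense sets $A_{\mathcal T}, B_{\mathcal T} \subseteq \mathbb R$ such that whenever $\mathbb P$ is reasonable for $A_{\mathcal T}$ and $B_{\mathcal T}$, in every generic extension by $\mathbb P$ there is a pseudointersection of $\mathcal T$; that is, every condition of $\mathbb P$ forces "$\check{\mathcal T}$ has a pseudointersection". -/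

import Mathlib

open scoped Cardinal FirstOrder

universe u

/-! ### Almost inclusion, towers and dense sets of reals -/

/-- `Y ⊆* Z`: all but finitely many elements of `Y` belong to `Z`. -/
def AlmostSubset (Y Z : Set ℕ) : Prop := (Y \ Z).Finite

/-- A tower: a set of infinite subsets of `ℕ` that is reverse well-ordered by `⊆*`. The relation
below is the strict part of the reverse of `⊆*`. -/
structure IsTower (T : Set (Set ℕ)) : Prop where
  infinite : ∀ Y ∈ T, Y.Infinite
  wellOrder : IsWellOrder T
    (fun Y Z => AlmostSubset (Z : Set ℕ) (Y : Set ℕ) ∧ ¬ AlmostSubset (Y : Set ℕ) (Z : Set ℕ))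

/-- A set of reals is `ℵ₁`-dense if it meets every nonempty open interval in exactly
`ℵ₁` points. -/
def IsAleph1Dense (A : Set ℝ) : Prop :=
  ∀ a b : ℝ, a < b → #(↥(A ∩ Set.Ioo a b)) = ℵ₁

/-! ### Finite partial isomorphisms and reasonable posets -/

/-- A finite partial isomorphism from `A` to `B`, as a finite set of pairs. As the orders are
linear, `lt_iff` makes the set of pairs the graph of a strictly increasing (hence injective)
function. -/
structure FinPartialIso (A B : Set ℝ) where
  graph : Finset (ℝ × ℝ)
  fst_mem : ∀ z ∈ graph, z.1 ∈ A
  snd_mem : ∀ z ∈ graph, z.2 ∈ B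
  lt_iff : ∀ z ∈ graph, ∀ w ∈ graph, (z.1 < w.1 ↔ z.2 < w.2)

namespace FinPartialIso

variable {A B : Set ℝ}

/-- The forcing order: `q ≤ p` (`q` is stronger than `p`) iff the map `q` extends the map `p`. -/
instance : PartialOrder (FinPartialIso A B) where
  le q p := p.graph ⊆ q.graph
  le_refl p := subset_refl p.graph
  le_trans _ _ _ h₁ h₂ := subset_trans h₂ h₁
  le_antisymm p q h₁ h₂ := by
    cases p; cases q
    congr
    exact subset_antisymm h₂ h₁

/-- The domain of a finite partial isomorphism. -/
def dom (p : FinPartialIso A B) : Set ℝ := {x | ∃ y, (x, y) ∈ p.graph}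

/-- The restriction `p ↾ Z`. -/
noncomputable def restrict (p : FinPartialIso A B) (Z : Finset ℝ) : FinPartialIso A B where
  graph := p.graph.filter (fun z => z.1 ∈ Z)
  fst_mem z hz := p.fst_mem z (Finset.mem_filter.1 hz).1
  snd_mem z hz := p.snd_mem z (Finset.mem_filter.1 hz).1
  lt_iff z hz w hw := p.lt_iff z (Finset.mem_filter.1 hz).1 w (Finset.mem_filter.1 hw).1

/-- For `x ∉ dom p`, the open interval `(p x₀, p x₁)`, where `x₀` is the largest element of `dom p`
below `x` and `x₁` is the smallest element of `dom p` above `x`; if there is no such `x₀` (or `x₁`)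
then the interval is unbounded below (or above). As `p` is increasing, `y` lies in this interval
iff it is above all values of `p` at points below `x` and below all values at points above `x`. -/
def gap (p : FinPartialIso A B) (x : ℝ) : Set ℝ :=
  {y | ∀ z ∈ p.graph, (z.1 < x → z.2 < y) ∧ (x < z.1 → y < z.2)}

end FinPartialIso

/-- A (nonempty) set `P` of finite partial isomorphisms from `A` to `B`, ordered by extension of
maps, is a reasonable poset for `A` and `B`. -/
structure IsReasonable {A B : Set ℝ} (P : Set (FinPartialIso A B)) : Prop where
  nonempty : P.Nonempty
  restriction : ∀ p ∈ P, ∀ Z : Finset ℝ, (Z : Set ℝ) ⊆ p.dom → p.restrict Z ∈ P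
  denseMapping : ∀ p ∈ P, ∀ x ∈ A, x ∉ p.dom →
    ∀ c d : ℝ, c < d → Set.Ioo c d ⊆ p.gap x →
      ∃ q ∈ P, q ≤ p ∧ ∃ y ∈ Set.Ioo c d, (x, y) ∈ q.graph

/-! ### Forcing: names and the forcing relation -/

/-- `P`-names: a name is a family (indexed by a small type) of pairs `(σ, p)` of a name `σ` and a
condition `p`. -/
inductive PName (P : Type u) : Type (u + 1)
  | mk (ι : Type u) (elt : ι → PName P) (cond : ι → P) : PName P

namespace PName

variable {P : Type u}

/-- The canonical name `x̌ = {(y̌, p) : y ∈ x, p ∈ P}` of a ground model set `x`. -/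
def check (P : Type u) : PSet.{u} → PName P
  | ⟨ι, x⟩ => ⟨ι × P, fun i => check P (x i.1), fun i => i.2⟩

variable [Preorder P]

/-- `p ⊩ σ = τ`: for each pair `(π, s)` in `σ`, each `q ≤ p, s` forces `π ∈ τ`, and symmetrically.
Here `q ⊩ π ∈ τ` is unfolded: for densely many `r ≤ q` there is `(π', s') ∈ τ` with `r ≤ s'` and
`r ⊩ π = π'`. -/
def ForcesEq : PName P → PName P → P → Prop
  | ⟨_, A, a⟩, ⟨_, B, b⟩ => fun p =>
    (∀ i, ∀ q ≤ p, q ≤ a i → ∀ q' ≤ q, ∃ r ≤ q', ∃ j, r ≤ b j ∧ ForcesEq (A i) (B j) r) ∧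
    (∀ j, ∀ q ≤ p, q ≤ b j → ∀ q' ≤ q, ∃ r ≤ q', ∃ i, r ≤ a i ∧ ForcesEq (A i) (B j) r)

/-- `p ⊩ σ ∈ τ`: the set of `r` such that `r ≤ s` and `r ⊩ σ = π` for some pair `(π, s)` in `τ` is
dense below `p`. -/
def ForcesMem (σ : PName P) : PName P → P → Prop
  | ⟨_, B, b⟩ => fun p => ∀ q ≤ p, ∃ r ≤ q, ∃ j, r ≤ b j ∧ ForcesEq σ (B j) r

end PName

/-- The only symbol of the language of set theory is the binary relation symbol `∈`. -/
inductive MemRel : ℕ → Type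
  | mem : MemRel 2

/-- The first-order language `{∈}` of set theory (equality is a logical symbol). -/
def setLang : FirstOrder.Language := ⟨fun _ => Empty, MemRel⟩

namespace setLang

/-- The atomic formula `t₁ ∈ t₂`. -/
def mem {n : ℕ} (t₁ t₂ : setLang.Term (Empty ⊕ Fin n)) : setLang.BoundedFormula Empty n :=
  FirstOrder.Language.Relations.boundedFormula₂ (L := setLang) MemRel.mem t₁ t₂

/-- The name denoted by a term (that is, by a variable) under an assignment of names. -/
def termName {P : Type u} {n : ℕ} (v : Fin n → PName P) :
    setLang.Term (Empty ⊕ Fin n) → PName P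
  | .var x => Sum.elim Empty.elim v x
  | .func f _ => Empty.elim f

/-- The forcing relation `p ⊩ φ(v)` for formulas `φ` of set theory, `v` assigning names to the
variables. The formulas are built from `⊥`, `→`, `∀`; the other connectives are abbreviations, so
that for instance `p ⊩ ¬φ` iff no `q ≤ p` forces `φ`, and `p ⊩ ∃ x, φ` iff for densely many `q`
below `p` there is a name `σ` with `q ⊩ φ(σ)`. -/
def Forces {P : Type u} [Preorder P] :
    ∀ {n : ℕ}, setLang.BoundedFormula Empty n → (Fin n → PName P) → P → Prop
  | _, .falsum, _, _ => False
  | _, .equal t₁ t₂, v, p => PName.ForcesEq (termName v t₁) (termName v t₂) p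
  | _, .rel MemRel.mem ts, v, p => PName.ForcesMem (termName v (ts 0)) (termName v (ts 1)) p
  | _, .imp φ ψ, v, p => ∀ q ≤ p, Forces φ v q → Forces ψ v q
  | _, .all φ, v, p => ∀ σ : PName P, Forces φ (Fin.snoc v σ) p

/-- `φ(v)` holds in every generic extension by `P`: it is forced by every condition. -/
def HoldsInGenericExtensions (P : Type u) [Preorder P] {n : ℕ}
    (φ : setLang.BoundedFormula Empty n) (v : Fin n → PName P) : Prop :=
  ∀ p : P, Forces φ v p

/-- The formula, with parameters `&0` (for `ω`) and `&1` (for a family `t` of subsets of `ω`),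
which says that `t` has a pseudointersection: there is `z` (the variable `&2`) such that
* `z ⊆ ω`,
* `z` is infinite: for every `k ∈ ω` there is `n ∈ z` with `n ∉ k` (that is, `n ≥ k`),
* `z ⊆* y` for every `y ∈ t`: there is `k ∈ ω` with `z ∖ k ⊆ y`. -/
def hasPseudointersection : setLang.BoundedFormula Empty 2 :=
  ∃' ((∀' (mem (&3) (&2) ⟹ mem (&3) (&0))) ⊓
    ((∀' (mem (&3) (&0) ⟹ ∃' (mem (&4) (&2) ⊓ ∼(mem (&4) (&3))))) ⊓
    (∀' (mem (&3) (&1) ⟹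
      ∃' (mem (&4) (&0) ⊓
        ∀' (mem (&5) (&2) ⟹ (∼(mem (&5) (&4)) ⟹ mem (&5) (&3))))))))

end setLang

/-- A set of natural numbers as a set of finite von Neumann ordinals. -/
def natSetToPSet (Y : Set ℕ) : PSet.{0} := ⟨Y, fun n => PSet.ofNat (n : ℕ)⟩

/-- A family of sets of natural numbers as a set of sets of finite von Neumann ordinals. -/
def familyToPSet (T : Set (Set ℕ)) : PSet.{0} := ⟨T, fun Y => natSetToPSet (Y : Set ℕ)⟩

/-- In every generic extension by the poset `P`, the family `T` (of the ground model) has a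
pseudointersection. -/
def AddsPseudointersection (P : Type) [Preorder P] (T : Set (Set ℕ)) : Prop :=
  setLang.HoldsInGenericExtensions P setLang.hasPseudointersection
    ![PName.check P PSet.omega, PName.check P (familyToPSet T)]

/-! The sets K_n = `digitSet n` are compact and nowhere dense, and every Y ⊆ ω is coded in every
open interval by a real x such that x ∈ K_n iff n ∉ Y, for almost all n. Pass to a cofinal C ⊆ T all
of whose initial segments are countable. If C is countable, T already has a pseudointersection.
Otherwise let A = B = `codeSet C`, the reals coding members of C.

Given finite sets F_n, let Z be the set of n such that some condition in the generic filter prevents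
the generic map from sending a point of K_n into K_n ∪ F_n.

Z is infinite: the points of dom p code finitely many members of C, which have arbitrarily large
common elements n, and for such n large enough dom p misses K_n. Cover K_n by finitely many
intervals with endpoints in A whose closures miss dom p, and send all endpoints lying in one gap of
p into a single interval missing K_n ∪ F_n. By monotonicity so is everything between the endpoints
of a covering interval (`exists_le_forall_notMem`).

Z ⊆* Y: it is enough that the generic map contains a pair (x, y) with x ∈ K_n and y ∈ K_n ∪ F_n for
almost all n ∉ Y. If pairs with both coordinates coding sets ⊆* Y occur densely for each Y ∈ C, take
F_n = ∅. Otherwise some q and Y₀ exclude such pairs, so below q the codes of sets ⊆* Y₀ go to codes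
of sets not ⊆* Y₀. The latter form a countable set, and F_n is taken to be the first n terms of an
enumeration of it. -/

namespace PName

/-! ### Forced equality and membership. -/

variable {P : Type u} [Preorder P]

theorem ForcesEq.mono {σ τ : PName P} {p q : P} (h : ForcesEq σ τ p) (hq : q ≤ p) :
    ForcesEq σ τ q := by
  cases σ; cases τ
  exact ⟨fun i r hr => h.1 i r (hr.trans hq), fun j r hr => h.2 j r (hr.trans hq)⟩

theorem ForcesEq.refl (σ : PName P) (p : P) : ForcesEq σ σ p := by
  induction σ generalizing p with
  | mk ι A a ih =>
    exact ⟨fun i q _ hi q' hq' => ⟨q', le_rfl, i, hq'.trans hi, ih i q'⟩,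
      fun i q _ hi q' hq' => ⟨q', le_rfl, i, hq'.trans hi, ih i q'⟩⟩

theorem ForcesEq.symm {σ τ : PName P} {p : P} (h : ForcesEq σ τ p) : ForcesEq τ σ p := by
  induction σ generalizing τ p with
  | mk ι A a ih =>
    cases τ
    constructor
    · intro j q hq hj q' hq'
      obtain ⟨r, hr, i, hi, e⟩ := h.2 j q hq hj q' hq'
      exact ⟨r, hr, i, hi, ih i e⟩
    · intro i q hq hi q' hq'
      obtain ⟨r, hr, j, hj, e⟩ := h.1 i q hq hi q' hq'
      exact ⟨r, hr, j, hj, ih i e⟩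

theorem ForcesEq.trans {σ τ ρ : PName P} {p : P} (h : ForcesEq σ τ p) (h' : ForcesEq τ ρ p) :
    ForcesEq σ ρ p := by
  induction σ generalizing τ ρ p with
  | mk ι A a ih =>
    cases τ; cases ρ
    constructor
    · intro i q hq hi q' hq'
      obtain ⟨r, hr, j, hj, e⟩ := h.1 i q hq hi q' hq'
      obtain ⟨s, hs, k, hk, e'⟩ := h'.1 j r (hr.trans (hq'.trans hq)) hj r le_rfl
      exact ⟨s, hs.trans hr, k, hk, ih i (e.mono hs) e'⟩
    · intro k q hq hk q' hq'
      obtain ⟨r, hr, j, hj, e⟩ := h'.2 k q hq hk q' hq'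
      obtain ⟨s, hs, i, hi, e'⟩ := h.2 j r (hr.trans (hq'.trans hq)) hj r le_rfl
      exact ⟨s, hs.trans hr, i, hi, ih i e' (e.mono hs)⟩

theorem ForcesMem.mono {σ τ : PName P} {p q : P} (h : ForcesMem σ τ p) (hq : q ≤ p) :
    ForcesMem σ τ q := by
  cases τ
  exact fun r hr => h r (hr.trans hq)

theorem ForcesMem.congr_right {σ τ ρ : PName P} {p : P} (h : ForcesMem σ τ p)
    (e : ForcesEq τ ρ p) : ForcesMem σ ρ p := by
  cases τ; cases ρ
  intro q hq
  obtain ⟨r, hr, j, hj, e'⟩ := h q hq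
  obtain ⟨s, hs, k, hk, e''⟩ := e.1 j r (hr.trans hq) hj r le_rfl
  exact ⟨s, hs.trans hr, k, hk, (e'.mono hs).trans e''⟩

theorem ForcesMem.exists_check {σ : PName P} {x : PSet.{u}} {p : P}
    (h : ForcesMem σ (check P x) p) :
    ∃ q ≤ p, ∃ i : x.Type, ForcesEq σ (check P (x.Func i)) q := by
  cases x
  obtain ⟨r, hr, j, -, e⟩ := h p le_rfl
  exact ⟨r, hr, j.1, e⟩

theorem ForcesEq.forcesMem_check {σ : PName P} {x : PSet.{u}} {p : P} (i : x.Type)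
    (h : ForcesEq σ (check P (x.Func i)) p) : ForcesMem σ (check P x) p := by
  cases x
  exact fun q hq => ⟨q, le_rfl, (i, q), le_rfl, h.mono hq⟩

end PName

/-! ### Canonical names of natural numbers. -/

theorem PSet.exists_func_ofNat {n m : ℕ} (h : m < n) :
    ∃ i : (PSet.ofNat.{u} n).Type, (PSet.ofNat n).Func i = PSet.ofNat.{u} m := by
  induction n with
  | zero => omega
  | succ n ih =>
    rcases (Nat.lt_succ_iff_lt_or_eq.1 h) with h | rfl
    · obtain ⟨i, hi⟩ := ih h
      exact ⟨some i, hi⟩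
    · exact ⟨none, rfl⟩

theorem PSet.exists_ofNat_func {n : ℕ} (i : (PSet.ofNat.{u} n).Type) :
    ∃ m < n, (PSet.ofNat n).Func i = PSet.ofNat.{u} m := by
  induction n with
  | zero => exact i.elim
  | succ n ih =>
    rcases i with _ | i
    · exact ⟨n, n.lt_succ_self, rfl⟩
    · obtain ⟨m, hm, e⟩ := ih i
      exact ⟨m, hm.trans n.lt_succ_self, e⟩

namespace PName

variable {P : Type u} [Preorder P]

/-- The canonical name of a natural number. -/
abbrev nat (P : Type u) (n : ℕ) : PName P := check P (PSet.ofNat n)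

theorem ForcesEq.forcesMem_nat {σ : PName P} {m n : ℕ} {p : P} (h : ForcesEq σ (nat P m) p)
    (hmn : m < n) : ForcesMem σ (nat P n) p := by
  obtain ⟨i, hi⟩ := PSet.exists_func_ofNat.{u} hmn
  exact ForcesEq.forcesMem_check i (hi ▸ h)

theorem ForcesMem.exists_nat {σ : PName P} {n : ℕ} {p : P} (h : ForcesMem σ (nat P n) p) :
    ∃ q ≤ p, ∃ m < n, ForcesEq σ (nat P m) q := by
  obtain ⟨q, hq, i, e⟩ := h.exists_check
  obtain ⟨m, hm, hi⟩ := PSet.exists_ofNat_func i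
  rw [hi] at e
  exact ⟨q, hq, m, hm, e⟩

/-- If m = n were forced with m < n, then m ∈ n = m would be forced, so some extension would force m
= l for an l < m, against the induction hypothesis for l. -/
theorem not_forcesEq_nat_of_lt {m n : ℕ} (h : m < n) (p : P) :
    ¬ ForcesEq (nat P m) (nat P n) p := by
  induction m using Nat.strong_induction_on generalizing n p with
  | _ m ih =>
    intro e
    obtain ⟨q, -, l, hl, e'⟩ :=
      (((ForcesEq.refl (nat P m) p).forcesMem_nat h).congr_right e.symm).exists_nat
    exact ih l hl hl q e'.symm

theorem ForcesEq.nat_inj {m n : ℕ} {p : P} (h : ForcesEq (nat P m) (nat P n) p) : m = n := by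
  rcases lt_trichotomy m n with hlt | rfl | hlt
  · exact (not_forcesEq_nat_of_lt hlt p h).elim
  · rfl
  · exact (not_forcesEq_nat_of_lt hlt p h.symm).elim

theorem ForcesMem.nat_lt {m n : ℕ} {p : P} (h : ForcesMem (nat P m) (nat P n) p) : m < n := by
  obtain ⟨q, -, l, hl, e⟩ := h.exists_nat
  exact e.nat_inj ▸ hl

/-- The name of the set of natural numbers `n` such that `D n` meets the generic filter. -/
def ofNatFamily {P : Type} (D : ℕ → Set P) : PName P :=
  ⟨Σ n, D n, fun i => nat P i.1, fun i => i.2.1⟩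

variable {Q : Type} [Preorder Q] {D : ℕ → Set Q}

theorem ForcesMem.exists_ofNatFamily {σ : PName Q} {p : Q} (h : ForcesMem σ (ofNatFamily D) p) :
    ∃ q ≤ p, ∃ n, ∃ d ∈ D n, q ≤ d ∧ ForcesEq σ (nat Q n) q := by
  obtain ⟨q, hq, ⟨n, d, hd⟩, hj, e⟩ := h p le_rfl
  exact ⟨q, hq, n, d, hd, hj, e⟩

theorem forcesMem_ofNatFamily {n : ℕ} {p : Q} (hp : p ∈ D n) :
    ForcesMem (nat Q n) (ofNatFamily D) p :=
  fun q hq => ⟨q, le_rfl, ⟨n, p, hp⟩, hq, ForcesEq.refl _ _⟩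

/-- To force membership in a name it suffices to do so densely. -/
theorem forcesMem_of_dense {σ τ : PName P} {p : P}
    (h : ∀ q ≤ p, ∃ r ≤ q, ForcesMem σ τ r) : ForcesMem σ τ p := by
  cases τ
  intro q hq
  obtain ⟨r, hr, h'⟩ := h q hq
  obtain ⟨s, hs, j, hj, e⟩ := h' r le_rfl
  exact ⟨s, hs.trans hr, j, hj, e⟩

end PName

/-! ### From dense sets of conditions to a forced pseudointersection. -/

namespace setLang

open FirstOrder.Language PName

variable {P : Type u} [Preorder P] {n : ℕ}

theorem Forces.mono {φ : setLang.BoundedFormula Empty n} {v : Fin n → PName P} {p q : P}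
    (h : Forces φ v p) (hq : q ≤ p) : Forces φ v q := by
  induction φ with
  | falsum => exact h
  | equal t₁ t₂ => exact ForcesEq.mono h hq
  | rel R ts => cases R; exact ForcesMem.mono h hq
  | imp φ ψ _ _ => exact fun r hr => h r (hr.trans hq)
  | all φ ih => exact fun σ => ih (h σ)

theorem forces_inf {φ ψ : setLang.BoundedFormula Empty n} {v : Fin n → PName P} {p : P}
    (h : Forces φ v p) (h' : Forces ψ v p) : Forces (φ ⊓ ψ) v p :=
  fun q hq k => k q le_rfl (h.mono hq) q le_rfl (h'.mono hq)

theorem forces_ex {φ : setLang.BoundedFormula Empty (n + 1)} {v : Fin n → PName P} {p : P}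
    (h : ∀ q ≤ p, ∃ r ≤ q, ∃ σ, Forces φ (Fin.snoc v σ) r) : Forces (∃' φ) v p := by
  intro q hq k
  obtain ⟨r, hr, σ, hσ⟩ := h q hq
  exact k σ r hr hσ

/-- A forcing adds a pseudointersection of `T` if, below densely many conditions, there is a family
`D` of sets of conditions for which `{n | D n meets the generic filter}` is one. -/
theorem addsPseudointersection_of_dense {P : Type} [Preorder P] {T : Set (Set ℕ)}
    (h : ∀ p : P, ∃ q ≤ p, ∃ D : ℕ → Set P,
      (∀ k, ∀ r ≤ q, ∃ s ≤ r, ∃ n ≥ k, s ∈ D n) ∧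
      ∀ Y ∈ T, ∀ r ≤ q, ∃ s ≤ r, ∃ k, ∀ n ≥ k, ∀ t ≤ s, (∃ d ∈ D n, t ≤ d) → n ∈ Y) :
    AddsPseudointersection P T := by
  intro p₀
  refine forces_ex fun p _ => ?_
  obtain ⟨q, hq, D, hinf, halm⟩ := h p
  refine ⟨q, hq, ofNatFamily D, ?_⟩
  refine forces_inf ?_ (forces_inf ?_ ?_)
  · intro σ r hr hσ
    refine forcesMem_of_dense fun s hs => ?_
    obtain ⟨t, ht, n, -, -, -, e⟩ :=
      (ForcesMem.mono (show ForcesMem σ (ofNatFamily D) r from hσ) hs).exists_ofNatFamily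
    exact ⟨t, ht, ForcesEq.forcesMem_check (x := PSet.omega) ⟨n⟩ e⟩
  · intro σ r hr hσ
    refine forces_ex fun s hs => ?_
    obtain ⟨t, ht, ⟨k⟩, e⟩ :=
      (ForcesMem.mono (show ForcesMem σ (check P PSet.omega) r from hσ) hs).exists_check
    obtain ⟨w, hw, n, hn, hD⟩ := hinf k t (ht.trans (hs.trans hr))
    refine ⟨w, hw.trans ht, nat P n, forces_inf (forcesMem_ofNatFamily hD) fun x hx hm => ?_⟩
    have hm' : ForcesMem (nat P n) σ x := hm
    exact hn.not_gt (hm'.congr_right (ForcesEq.mono e (hx.trans hw))).nat_lt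
  · intro σ r hr hσ
    refine forces_ex fun s hs => ?_
    obtain ⟨t, ht, ⟨Y, hY⟩, e⟩ :=
      (ForcesMem.mono (show ForcesMem σ (check P (familyToPSet T)) r from hσ) hs).exists_check
    obtain ⟨w, hw, k, hk⟩ := halm Y hY t (ht.trans (hs.trans hr))
    refine ⟨w, hw.trans ht, nat P k, forces_inf ?_ ?_⟩
    · exact ForcesEq.forcesMem_check (x := PSet.omega) ⟨k⟩ (ForcesEq.refl _ _)
    · intro τ x hx hτ y hy hnot
      have hτ' : ForcesMem τ (ofNatFamily D) x := hτ
      refine forcesMem_of_dense fun z hz => ?_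
      -- Extend until the element τ is decided to be a numeral n. The condition is then below a
      -- member of `D n`, as `hk` requires.
      obtain ⟨z', hz', n, d, hd, hzd, e'⟩ := (hτ'.mono (hz.trans hy)).exists_ofNatFamily
      have hnk : n ≥ k := by
        by_contra! hlt
        exact hnot z' (hz'.trans hz) (e'.forcesMem_nat hlt)
      have hzw : z' ≤ w := hz'.trans (hz.trans (hy.trans hx))
      have hnY := hk n hnk z' hzw ⟨d, hd, hzd⟩
      refine ⟨z', hz', ForcesMem.congr_right (τ := check P (natSetToPSet Y)) ?_
        (ForcesEq.mono e (hzw.trans hw)).symm⟩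
      exact ForcesEq.forcesMem_check (x := natSetToPSet Y) ⟨n, hnY⟩ e'

end setLang

/-! ### Almost inclusion and towers. -/

theorem AlmostSubset.trans {X Y Z : Set ℕ} (h : AlmostSubset X Y) (h' : AlmostSubset Y Z) :
    AlmostSubset X Z :=
  (h.union h').subset fun n hn => by
    by_cases hY : n ∈ Y
    · exact Or.inr ⟨hY, hn.2⟩
    · exact Or.inl ⟨hn.1, hY⟩

theorem AlmostSubset.refl (X : Set ℕ) : AlmostSubset X X := by simp [AlmostSubset]

theorem AlmostSubset.eventually {X Y : Set ℕ} (h : AlmostSubset X Y) :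
    ∀ᶠ n in Filter.atTop, n ∈ X → n ∈ Y := by
  have := h.eventually_cofinite_notMem
  rw [Nat.cofinite_eq_atTop] at this
  filter_upwards [this] with n hn hX
  by_contra hY
  exact hn ⟨hX, hY⟩

theorem AlmostSubset.of_eventually {X Y : Set ℕ} (h : ∀ᶠ n in Filter.atTop, n ∈ X → n ∈ Y) :
    AlmostSubset X Y := by
  rw [← Nat.cofinite_eq_atTop, Filter.eventually_cofinite] at h
  exact h.subset fun n hn h' => hn.2 (h' hn.1)

namespace IsTower

variable {T : Set (Set ℕ)}

theorem mono (hT : IsTower T) {C : Set (Set ℕ)} (hC : C ⊆ T) : IsTower C where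
  infinite Y hY := hT.infinite Y (hC hY)
  wellOrder := by
    have := hT.wellOrder
    exact (RelEmbedding.mk ⟨Set.inclusion hC, Set.inclusion_injective hC⟩ Iff.rfl :
      (fun Y Z : C => AlmostSubset (Z : Set ℕ) (Y : Set ℕ) ∧
        ¬ AlmostSubset (Y : Set ℕ) (Z : Set ℕ)) ↪r
      (fun Y Z : T => AlmostSubset (Z : Set ℕ) (Y : Set ℕ) ∧
        ¬ AlmostSubset (Y : Set ℕ) (Z : Set ℕ))).isWellOrder

theorem total (hT : IsTower T) {Y Z : Set ℕ} (hY : Y ∈ T) (hZ : Z ∈ T) :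
    AlmostSubset Y Z ∨ AlmostSubset Z Y := by
  have := hT.wellOrder
  rcases trichotomous_of (fun Y Z : T => AlmostSubset (Z : Set ℕ) (Y : Set ℕ) ∧
    ¬ AlmostSubset (Y : Set ℕ) (Z : Set ℕ)) ⟨Y, hY⟩ ⟨Z, hZ⟩ with h | h | h
  · exact Or.inr h.1
  · cases h; exact Or.inl (AlmostSubset.refl _)
  · exact Or.inl h.1

theorem eq_of_almostSubset (hT : IsTower T) {Y Z : Set ℕ} (hY : Y ∈ T) (hZ : Z ∈ T)
    (h : AlmostSubset Y Z) (h' : AlmostSubset Z Y) : Y = Z := by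
  have := hT.wellOrder
  rcases trichotomous_of (fun Y Z : T => AlmostSubset (Z : Set ℕ) (Y : Set ℕ) ∧
    ¬ AlmostSubset (Y : Set ℕ) (Z : Set ℕ)) ⟨Y, hY⟩ ⟨Z, hZ⟩ with e | e | e
  · exact (e.2 h).elim
  · cases e; rfl
  · exact (e.2 h').elim

theorem exists_almostSubset_finset (hT : IsTower T) (hne : T.Nonempty) (s : Finset (Set ℕ)) :
    ∃ Y ∈ T, ∀ Z ∈ s, Z ∈ T → AlmostSubset Y Z := by
  induction s using Finset.induction_on with
  | empty => exact ⟨hne.some, hne.some_mem, by simp⟩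
  | insert X s _ ih =>
    obtain ⟨Y, hY, h⟩ := ih
    by_cases hX : X ∈ T
    · rcases hT.total hX hY with hXY | hYX
      · refine ⟨X, hX, fun Z hZ hZT => ?_⟩
        rcases Finset.mem_insert.1 hZ with rfl | hZ
        · exact AlmostSubset.refl _
        · exact hXY.trans (h Z hZ hZT)
      · refine ⟨Y, hY, fun Z hZ hZT => ?_⟩
        rcases Finset.mem_insert.1 hZ with rfl | hZ
        · exact hYX
        · exact h Z hZ hZT
    · refine ⟨Y, hY, fun Z hZ hZT => ?_⟩
      rcases Finset.mem_insert.1 hZ with rfl | hZ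
      · exact (hX hZT).elim
      · exact h Z hZ hZT

theorem frequently_forall_mem (hT : IsTower T) (hne : T.Nonempty) {s : Finset (Set ℕ)}
    (hs : (s : Set (Set ℕ)) ⊆ T) : ∃ᶠ n in Filter.atTop, ∀ Z ∈ s, n ∈ Z := by
  obtain ⟨Y, hY, h⟩ := hT.exists_almostSubset_finset hne s
  have h₁ : ∃ᶠ n in Filter.atTop, n ∈ Y := Nat.frequently_atTop_iff_infinite.2 (hT.infinite Y hY)
  have h₂ : ∀ᶠ n in Filter.atTop, ∀ Z ∈ s, n ∈ Y → n ∈ Z :=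
    (Filter.eventually_all_finset s).2 fun Z hZ => (h Z hZ (hs hZ)).eventually
  exact (h₁.and_eventually h₂).mono fun n hn Z hZ => hn.2 Z hZ hn.1

/-- A countable tower has a pseudointersection. -/
theorem exists_pseudointersection (hT : IsTower T) (hc : T.Countable) :
    ∃ Z : Set ℕ, Z.Infinite ∧ ∀ Y ∈ T, AlmostSubset Z Y := by
  rcases T.eq_empty_or_nonempty with rfl | hne
  · exact ⟨Set.univ, Set.infinite_univ, by simp⟩
  obtain ⟨e, rfl⟩ := hc.exists_eq_range hne
  -- Diagonalize: the k-th point is at least k and lies in the first k + 1 members of the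
  -- enumeration.
  have H : ∀ k, ∃ n ≥ k, ∀ i ≤ k, n ∈ e i := fun k => by
    classical
    obtain ⟨n, hn, h⟩ := (Filter.frequently_atTop.1 (hT.frequently_forall_mem hne
      (s := (Finset.range (k + 1)).image e) (by
        intro x hx
        obtain ⟨i, -, rfl⟩ := Finset.mem_image.1 hx
        exact ⟨i, rfl⟩))) k
    exact ⟨n, hn, fun i hi => h _ (Finset.mem_image_of_mem e (Finset.mem_range_succ_iff.2 hi))⟩
  choose z hz hz' using H
  refine ⟨Set.range z, Set.infinite_of_not_bddAbove ?_, ?_⟩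
  · rintro ⟨b, hb⟩
    exact absurd (hb ⟨b + 1, rfl⟩) (not_le.2 (hz (b + 1)))
  · rintro _ ⟨i, rfl⟩
    refine ((Set.finite_lt_nat i).image z).subset ?_
    rintro _ ⟨⟨k, rfl⟩, hk⟩
    exact ⟨k, not_le.1 fun hik => hk (hz' k i hik), rfl⟩

/-- A tower of size `ℵ₁` has a cofinal part all of whose initial segments are countable. -/
theorem exists_cofinal (hT : IsTower T) (hcard : #T = ℵ₁) :
    ∃ C ⊆ T, (∀ Y ∈ T, ∃ Z ∈ C, AlmostSubset Z Y) ∧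
      ∀ Y ∈ C, {Z ∈ C | ¬ AlmostSubset Z Y}.Countable := by
  -- The tower may have any order type of cardinality ℵ₁, so it is reindexed by a well-order `r` of
  -- type ω₁, whose initial segments are countable.
  obtain ⟨r, _, ho⟩ := Cardinal.exists_ord_eq T
  have hseg : ∀ Y : T, {Z | r Z Y}.Countable := fun Y => by
    rw [← Cardinal.le_aleph0_iff_set_countable, ← Cardinal.lt_aleph_one_iff, ← hcard]
    exact Cardinal.card_typein_lt Y ho
  -- Keep those Y that are not almost above any `r`-earlier member. The `r`-least member ⊆* Y is
  -- kept, which gives cofinality. On kept sets `r` agrees with the tower order, which gives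
  -- countable segments.
  refine ⟨{Y | ∃ h : Y ∈ T, ∀ Z : T, r Z ⟨Y, h⟩ → ¬ AlmostSubset Z Y}, fun Y hY => hY.1, ?_, ?_⟩
  · intro Y hY
    obtain ⟨Z, hZ, hmin⟩ := (IsWellFounded.wf (r := r)).has_min {Z : T | AlmostSubset Z Y}
      ⟨⟨Y, hY⟩, AlmostSubset.refl Y⟩
    exact ⟨Z, ⟨Z.2, fun X hX h => hmin X (h.trans hZ) hX⟩, hZ⟩
  · rintro Y ⟨hY, hmin⟩
    refine ((hseg ⟨Y, hY⟩).image Subtype.val).mono ?_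
    rintro Z ⟨⟨hZ, hZmin⟩, hZY⟩
    refine ⟨⟨Z, hZ⟩, ?_, rfl⟩
    rcases trichotomous_of r ⟨Z, hZ⟩ ⟨Y, hY⟩ with h | h | h
    · exact h
    · cases h; exact (hZY (AlmostSubset.refl _)).elim
    · exact ((hT.total hY hZ).elim (hZmin ⟨Y, hY⟩ h) hZY).elim

end IsTower

/-! ### Coding sets of natural numbers by reals -/

/-- The reals in `[-n, n]` whose expansion in base `4` has the digit `1` at place `n`, followed by
digits `0` and `1` only. -/
def digitSet (n : ℕ) : Set ℝ :=
  {x | |x| ≤ n ∧ (∀ m : ℤ, 1 / 4 ≤ |4 ^ n * x - m|) ∧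
    ∀ j > n, ∀ m : ℤ, 4 ^ j * x ∉ Set.Ioo (m + 1 / 3 : ℝ) (m + 1)}

theorem isCompact_digitSet (n : ℕ) : IsCompact (digitSet n) := by
  refine (isCompact_Icc (a := -(n : ℝ)) (b := n)).of_isClosed_subset ?_
    fun x hx => abs_le.1 hx.1
  have h₁ : IsClosed {x : ℝ | |x| ≤ n} := isClosed_le (by fun_prop) (by fun_prop)
  have h₂ : IsClosed {x : ℝ | ∀ m : ℤ, 1 / 4 ≤ |4 ^ n * x - m|} := by
    simp only [Set.ofPred_forall]
    exact isClosed_iInter fun m => isClosed_le (by fun_prop) (by fun_prop)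
  have h₃ : IsClosed {x : ℝ | ∀ j > n, ∀ m : ℤ,
      4 ^ j * x ∉ Set.Ioo (m + 1 / 3 : ℝ) (m + 1)} := by
    simp only [Set.ofPred_forall]
    exact isClosed_iInter fun j => isClosed_iInter fun _ => isClosed_iInter fun m =>
      (isOpen_Ioo.preimage (by fun_prop : Continuous fun x : ℝ => 4 ^ j * x)).isClosed_compl
  exact h₁.inter (h₂.inter h₃)

theorem exists_lt_four_pow (x : ℝ) (n : ℕ) : ∃ j > n, x < 4 ^ j := by
  obtain ⟨k, hk⟩ := pow_unbounded_of_one_lt x (by norm_num : (1 : ℝ) < 4)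
  exact ⟨max (n + 1) k, by omega, hk.trans_le (pow_le_pow_right₀ (by norm_num) (le_max_right _ _))⟩

/-- Any interval contains, for large j, a point x with 4^j x a half-integer, and this violates the
digit condition at place j. -/
theorem interior_digitSet (n : ℕ) : interior (digitSet n) = ∅ := by
  rw [← Set.not_nonempty_iff_eq_empty]
  rintro ⟨x, hx⟩
  obtain ⟨l, u, hlu, hsub⟩ := mem_nhds_iff_exists_Ioo_subset.1 (mem_interior_iff_mem_nhds.1 hx)
  have hlu' : 0 < u - l := sub_pos.2 (hlu.1.trans hlu.2)
  obtain ⟨j, hj, hj'⟩ := exists_lt_four_pow (1 / (u - l)) n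
  have h4 : (0 : ℝ) < 4 ^ j := by positivity
  rw [div_lt_iff₀ hlu'] at hj'
  have hm := Int.floor_le (4 ^ j * l + 1 / 2 : ℝ)
  have hm' := Int.lt_floor_add_one (4 ^ j * l + 1 / 2 : ℝ)
  set m := ⌊(4 ^ j * l + 1 / 2 : ℝ)⌋
  have hy : 4 ^ j * (((m : ℝ) + 1 / 2) / 4 ^ j) = m + 1 / 2 := by field_simp
  refine (hsub (show ((m : ℝ) + 1 / 2) / 4 ^ j ∈ Set.Ioo l u from ⟨?_, ?_⟩)).2.2 j hj m ?_
  · rw [lt_div_iff₀ h4]; linarith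
  · rw [div_lt_iff₀ h4]; linarith
  · rw [hy]; constructor <;> linarith

/-- The tails of a base `4` expansion with digits `0` and `1`. -/
theorem exists_digit_tails (ε : ℕ → ℝ) (hε : ∀ n, ε n ∈ Set.Icc (0 : ℝ) 1) :
    ∃ g : ℕ → ℝ, ∀ n, 0 ≤ g n ∧ g n ≤ 1 / 3 ∧ 4 * g n = ε n + g (n + 1) := by
  have hs : Summable fun i : ℕ => (1 / 4 : ℝ) * (1 / 4) ^ i :=
    (summable_geometric_of_lt_one (by norm_num) (by norm_num)).mul_left _
  have hle : ∀ n i, ε (n + i) * ((1 / 4) * (1 / 4) ^ i) ≤ (1 / 4 : ℝ) * (1 / 4) ^ i :=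
    fun n i => mul_le_of_le_one_left (by positivity) (hε _).2
  have hnn : ∀ n i, 0 ≤ ε (n + i) * ((1 / 4 : ℝ) * (1 / 4) ^ i) :=
    fun n i => mul_nonneg (hε _).1 (by positivity)
  have hs' : ∀ n, Summable fun i => ε (n + i) * ((1 / 4 : ℝ) * (1 / 4) ^ i) :=
    fun n => hs.of_nonneg_of_le (hnn n) (hle n)
  refine ⟨fun n => ∑' i, ε (n + i) * ((1 / 4) * (1 / 4) ^ i), fun n =>
    ⟨tsum_nonneg (hnn n), ?_, ?_⟩⟩
  · refine ((hs' n).tsum_le_tsum (hle n) hs).trans_eq ?_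
    rw [tsum_mul_left, tsum_geometric_of_lt_one (by norm_num) (by norm_num)]
    norm_num
  · beta_reduce
    rw [(hs' n).tsum_eq_zero_add, mul_add, ← tsum_mul_left]
    congr 1
    · rw [pow_zero, add_zero]
      ring
    · refine tsum_congr fun i => ?_
      rw [show n + (i + 1) = n + 1 + i by ring]
      ring

theorem exists_code (Y : Set ℕ) {c d : ℝ} (h : c < d) :
    ∃ x ∈ Set.Ioo c d, ∀ᶠ n in Filter.atTop, x ∈ digitSet n ↔ n ∉ Y := by
  classical
  obtain ⟨g, hg⟩ := exists_digit_tails (fun n => if n ∈ Y then 0 else 1)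
    (fun n => by split_ifs <;> simp)
  -- At scale 4^N the interval has length more than 2, so it contains k + 1 + [0, 1/3], where k is
  -- the floor of its left endpoint. Digits are prescribed only from place N on.
  obtain ⟨N, -, hN⟩ := exists_lt_four_pow (2 / (d - c)) 0
  rw [div_lt_iff₀ (sub_pos.2 h)] at hN
  have h4 : (0 : ℝ) < 4 ^ N := by positivity
  have hk := Int.floor_le (4 ^ N * c : ℝ)
  have hk' := Int.lt_floor_add_one (4 ^ N * c : ℝ)
  set k := ⌊(4 ^ N * c : ℝ)⌋
  obtain ⟨hg0, hg1, -⟩ := hg N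
  set x : ℝ := ((k : ℝ) + 1 + g N) / 4 ^ N with hx
  have hxN : 4 ^ N * x = (k : ℝ) + 1 + g N := by rw [hx]; field_simp
  have key : ∀ n ≥ N, ∃ m : ℤ, 4 ^ n * x = m + g n := by
    intro n hn
    induction n, hn using Nat.le_induction with
    | base => exact ⟨k + 1, by rw [hxN]; push_cast; ring⟩
    | succ n _ ih =>
      obtain ⟨m, hm⟩ := ih
      refine ⟨4 * m + if n ∈ Y then 0 else 1, ?_⟩
      have := (hg n).2.2
      rw [pow_succ]
      push_cast
      linarith
  refine ⟨x, ⟨?_, ?_⟩, ?_⟩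
  · rw [hx, lt_div_iff₀ h4]; linarith
  · rw [hx, div_lt_iff₀ h4]; linarith
  · filter_upwards [Filter.eventually_ge_atTop N, Filter.eventually_ge_atTop ⌈|x|⌉₊] with n hn hn'
    obtain ⟨m, hm⟩ := key n hn
    obtain ⟨h0, h1, h2⟩ := hg n
    obtain ⟨h0', h1', -⟩ := hg (n + 1)
    constructor
    -- Digit 0 gives 4 g(n) = g(n+1) ≤ 1/3, so 4^n x is within 1/12 of an integer. In the converse,
    -- digit 1 puts g(n) in [1/4, 1/3], at distance at least 1/4 from all integers.
    · rintro ⟨-, hx2, -⟩ hY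
      have := hx2 m
      rw [hm, add_sub_cancel_left, abs_of_nonneg h0] at this
      simp only [if_pos hY] at h2
      linarith
    · intro hY
      simp only [if_neg hY] at h2
      refine ⟨(Nat.le_ceil _).trans (by exact_mod_cast hn'), fun i => ?_, fun j hj i hi => ?_⟩
      · rw [hm]
        rcases le_or_gt i m with hi | hi
        · have : (i : ℝ) ≤ m := by exact_mod_cast hi
          refine le_trans ?_ (le_abs_self _)
          linarith
        · have : (m : ℝ) + 1 ≤ i := by exact_mod_cast hi
          refine le_trans ?_ (neg_le_abs _)
          linarith
      · obtain ⟨l, hl⟩ := key j (hn.trans hj.le)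
        obtain ⟨h0, h1, -⟩ := hg j
        rw [hl] at hi
        obtain ⟨hi1, hi2⟩ := hi
        have a1 : (i : ℝ) < l := by linarith
        have a2 : (l : ℝ) < i + 1 := by linarith
        norm_cast at a1 a2
        omega

/-- A real in `(c, d)` that codes `Y`. -/
noncomputable def code (Y : Set ℕ) (c d : ℝ) : ℝ :=
  if h : c < d then (exists_code Y h).choose else 0

theorem code_mem_Ioo (Y : Set ℕ) {c d : ℝ} (h : c < d) : code Y c d ∈ Set.Ioo c d := by
  rw [code, dif_pos h]; exact (exists_code Y h).choose_spec.1

theorem eventually_code_mem (Y : Set ℕ) {c d : ℝ} (h : c < d) :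
    ∀ᶠ n in Filter.atTop, code Y c d ∈ digitSet n ↔ n ∉ Y := by
  rw [code, dif_pos h]; exact (exists_code Y h).choose_spec.2

/-- The reals coding members of `C` in intervals with rational endpoints. -/
def codeSet (C : Set (Set ℕ)) : Set ℝ :=
  {x | ∃ Y ∈ C, ∃ c d : ℚ, (c : ℝ) < d ∧ code Y c d = x}

theorem codeSet_eq_image (C : Set (Set ℕ)) :
    codeSet C = (fun y : Set ℕ × ℚ × ℚ => code y.1 y.2.1 y.2.2) ''
      (C ×ˢ {y : ℚ × ℚ | (y.1 : ℝ) < y.2}) := by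
  ext x
  constructor
  · rintro ⟨Y, hY, c, d, h, rfl⟩
    exact ⟨(Y, c, d), ⟨hY, h⟩, rfl⟩
  · rintro ⟨⟨Y, c, d⟩, ⟨hY, h⟩, rfl⟩
    exact ⟨Y, hY, c, d, h, rfl⟩

theorem countable_codeSet {C : Set (Set ℕ)} (hC : C.Countable) : (codeSet C).Countable := by
  rw [codeSet_eq_image]
  exact (hC.prod (Set.to_countable _)).image _

theorem eventually_mem_digitSet_of_mem_codeSet {C : Set (Set ℕ)} {x : ℝ} (hx : x ∈ codeSet C) :
    ∃ Y ∈ C, x ∈ codeSet {Y} ∧ ∀ᶠ n in Filter.atTop, x ∈ digitSet n ↔ n ∉ Y := by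
  obtain ⟨Y, hY, c, d, h, rfl⟩ := hx
  exact ⟨Y, hY, ⟨Y, rfl, c, d, h, rfl⟩, eventually_code_mem Y h⟩

theorem exists_mem_codeSet_Ioo {C : Set (Set ℕ)} (hC : C.Nonempty) {c d : ℝ} (h : c < d) :
    ∃ x ∈ codeSet C, x ∈ Set.Ioo c d := by
  obtain ⟨q, hcq, hqd⟩ := exists_rat_btwn h
  obtain ⟨r, hqr, hrd⟩ := exists_rat_btwn hqd
  obtain ⟨Y, hY⟩ := hC
  have := code_mem_Ioo Y hqr
  exact ⟨_, ⟨Y, hY, q, r, hqr, rfl⟩, hcq.trans this.1, this.2.trans hrd⟩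

/-- A code determines its set modulo finite, so within a fixed rational interval distinct members of
the tower have distinct codes. The upper bound is ℵ₁ · ℵ₀. -/
theorem IsTower.isAleph1Dense_codeSet {C : Set (Set ℕ)} (hC : IsTower C) (hcard : #C = ℵ₁) :
    IsAleph1Dense (codeSet C) := by
  intro c d h
  apply le_antisymm
  · refine (Cardinal.mk_le_mk_of_subset Set.inter_subset_left).trans ?_
    rw [codeSet_eq_image]
    refine Cardinal.mk_image_le.trans ?_
    rw [Cardinal.mk_setProd, hcard]
    refine Cardinal.mul_le_of_le Cardinal.aleph0_lt_aleph_one.le le_rfl ?_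
    exact (Cardinal.mk_le_aleph0).trans Cardinal.aleph0_lt_aleph_one.le
  · obtain ⟨q, hcq, hqd⟩ := exists_rat_btwn h
    obtain ⟨r, hqr, hrd⟩ := exists_rat_btwn hqd
    rw [← hcard]
    refine Cardinal.mk_le_of_injective (f := fun Y : C => (⟨code Y q r,
      ⟨Y, Y.2, q, r, hqr, rfl⟩, hcq.trans (code_mem_Ioo Y hqr).1,
      (code_mem_Ioo Y hqr).2.trans hrd⟩ : ↥(codeSet C ∩ Set.Ioo c d))) ?_
    intro Y Z hYZ
    have e : code Y q r = code Z q r := congrArg Subtype.val hYZ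
    have hY := eventually_code_mem Y hqr
    rw [e] at hY
    have hZ := eventually_code_mem Z hqr
    refine Subtype.ext (hC.eq_of_almostSubset Y.2 Z.2 ?_ ?_)
    · refine AlmostSubset.of_eventually ?_
      filter_upwards [hY, hZ] with n h₁ h₂
      tauto
    · refine AlmostSubset.of_eventually ?_
      filter_upwards [hY, hZ] with n h₁ h₂
      tauto

theorem exists_Ioo_between_finsets (lo hi : Finset ℝ) (h : ∀ x ∈ lo, ∀ y ∈ hi, x < y) :
    ∃ c d, c < d ∧ ∀ y ∈ Set.Ioo c d, (∀ x ∈ lo, x < y) ∧ ∀ x ∈ hi, y < x := by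
  obtain ⟨c, hc, hc'⟩ := Order.exists_between_finsets lo hi h
  obtain ⟨d, hd, hd'⟩ := Order.exists_between_finsets (insert c lo) hi (by
    intro x hx y hy
    rcases Finset.mem_insert.1 hx with rfl | hx
    · exact hc' y hy
    · exact h x hx y hy)
  exact ⟨c, d, hd c (Finset.mem_insert_self _ _),
    fun y hy => ⟨fun x hx => (hc x hx).trans hy.1, fun x hx => hy.2.trans (hd' x hx)⟩⟩

theorem exists_Ioo_subset_of_interior_eq_empty {S : Set ℝ} (hS : IsClosed S)
    (hS' : interior S = ∅) {c d : ℝ} (h : c < d) :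
    ∃ c' d', c' < d' ∧ Set.Ioo c' d' ⊆ Set.Ioo c d ∧ Set.Ioo c' d' ⊆ Sᶜ := by
  obtain ⟨x, hx, hxS⟩ : ∃ x ∈ Set.Ioo c d, x ∉ S := by
    by_contra! hsub
    have := interior_maximal hsub isOpen_Ioo
    rw [hS'] at this
    exact (Set.nonempty_Ioo.2 h).ne_empty (Set.subset_empty_iff.1 this)
  obtain ⟨c', d', hx', hsub⟩ := mem_nhds_iff_exists_Ioo_subset.1
    ((isOpen_Ioo.inter hS.isOpen_compl).mem_nhds ⟨hx, hxS⟩)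
  exact ⟨c', d', hx'.1.trans hx'.2, fun y hy => (hsub hy).1, fun y hy => (hsub hy).2⟩

theorem IsAleph1Dense.exists_mem_Ioo {A : Set ℝ} (hA : IsAleph1Dense A) {c d : ℝ} (h : c < d) :
    ∃ x ∈ A, x ∈ Set.Ioo c d := by
  have : #(↥(A ∩ Set.Ioo c d)) ≠ 0 := by
    rw [hA c d h]
    exact (Cardinal.aleph_pos 1).ne'
  obtain ⟨x, hx⟩ := Cardinal.mk_ne_zero_iff.1 this
  exact ⟨x, hx.1, hx.2⟩

/-! ### Gaps of a finite partial isomorphism. -/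

namespace FinPartialIso

variable {A B : Set ℝ}

theorem snd_eq (p : FinPartialIso A B) {x y y' : ℝ} (h : (x, y) ∈ p.graph)
    (h' : (x, y') ∈ p.graph) : y = y' := by
  have h₁ := p.lt_iff _ h _ h'
  have h₂ := p.lt_iff _ h' _ h
  simp only [lt_self_iff_false, false_iff, not_lt] at h₁ h₂
  exact le_antisymm h₂ h₁

/-- The part of `p` below `x`. -/
noncomputable def cut (p : FinPartialIso A B) (x : ℝ) : Finset (ℝ × ℝ) :=
  p.graph.filter fun z => z.1 < x

theorem mem_cut {p : FinPartialIso A B} {x : ℝ} {z : ℝ × ℝ} :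
    z ∈ p.cut x ↔ z ∈ p.graph ∧ z.1 < x :=
  Finset.mem_filter

theorem lt_iff_of_cut_eq {p : FinPartialIso A B} {x x' : ℝ} (h : p.cut x = p.cut x')
    {z : ℝ × ℝ} (hz : z ∈ p.graph) : z.1 < x ↔ z.1 < x' := by
  have : z ∈ p.cut x ↔ z ∈ p.cut x' := by rw [h]
  simpa [mem_cut, hz] using this

theorem gap_eq_of_cut_eq {p : FinPartialIso A B} {x x' : ℝ} (hx : x ∉ p.dom) (hx' : x' ∉ p.dom)
    (h : p.cut x = p.cut x') : p.gap x = p.gap x' := by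
  have H : ∀ z ∈ p.graph, (x < z.1 ↔ x' < z.1) := fun z hz => by
    have h₁ : z.1 ≠ x := fun e => hx ⟨z.2, e ▸ hz⟩
    have h₂ : z.1 ≠ x' := fun e => hx' ⟨z.2, e ▸ hz⟩
    rw [← not_le, ← not_le, h₁.le_iff_lt, h₂.le_iff_lt, lt_iff_of_cut_eq h hz]
  ext y
  exact forall₂_congr fun z hz => by rw [lt_iff_of_cut_eq h hz, H z hz]

theorem exists_Ioo_subset_gap (p : FinPartialIso A B) (x : ℝ) :
    ∃ c d, c < d ∧ Set.Ioo c d ⊆ p.gap x := by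
  classical
  obtain ⟨c, d, h, H⟩ := exists_Ioo_between_finsets
    ((p.graph.filter fun z => z.1 < x).image Prod.snd)
    ((p.graph.filter fun z => x < z.1).image Prod.snd) (by
      simp only [Finset.mem_image, Finset.mem_filter]
      rintro _ ⟨z, ⟨hz, hzx⟩, rfl⟩ _ ⟨w, ⟨hw, hwx⟩, rfl⟩
      exact (p.lt_iff z hz w hw).1 (hzx.trans hwx))
  refine ⟨c, d, h, fun y hy z hz => ⟨fun hzx => (H y hy).1 _ ?_, fun hxz => (H y hy).2 _ ?_⟩⟩
  · exact Finset.mem_image_of_mem _ (Finset.mem_filter.2 ⟨hz, hzx⟩)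
  · exact Finset.mem_image_of_mem _ (Finset.mem_filter.2 ⟨hz, hxz⟩)

/-- Inside each gap of `p` there is an interval missing `S`, chosen uniformly for all points
with the same gap. -/
theorem exists_Ioo_cut (p : FinPartialIso A B) {S : Set ℝ} (hS : IsClosed S)
    (hS' : interior S = ∅) :
    ∃ u v : Finset (ℝ × ℝ) → ℝ, ∀ x ∉ p.dom, u (p.cut x) < v (p.cut x) ∧
      Set.Ioo (u (p.cut x)) (v (p.cut x)) ⊆ p.gap x ∧
      Set.Ioo (u (p.cut x)) (v (p.cut x)) ⊆ Sᶜ := by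
  have H : ∀ L, ∃ c d, ∀ x ∉ p.dom, p.cut x = L →
      c < d ∧ Set.Ioo c d ⊆ p.gap x ∧ Set.Ioo c d ⊆ Sᶜ := fun L => by
    by_cases h : ∃ x ∉ p.dom, p.cut x = L
    · obtain ⟨x, hx, rfl⟩ := h
      obtain ⟨c, d, hcd, hsub⟩ := p.exists_Ioo_subset_gap x
      obtain ⟨c', d', hcd', hsub₁, hsub₂⟩ := exists_Ioo_subset_of_interior_eq_empty hS hS' hcd
      refine ⟨c', d', fun x' hx' he => ⟨hcd', ?_, hsub₂⟩⟩
      rw [gap_eq_of_cut_eq hx' hx he]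
      exact hsub₁.trans hsub
    · exact ⟨0, 0, fun x hx he => (h ⟨x, hx, he⟩).elim⟩
  choose u v H using H
  exact ⟨u, v, fun x hx => H _ x hx rfl⟩

end FinPartialIso

/-! ### Controlled extensions in a reasonable poset. -/

namespace IsReasonable

open FinPartialIso

variable {A B : Set ℝ} {P : Set (FinPartialIso A B)}

/-- The extension supplied by dense mapping may contain further, uncontrolled pairs; closure under
restriction removes them. -/
theorem exists_insert (hP : IsReasonable P) {p : FinPartialIso A B} (hp : p ∈ P) {x : ℝ}
    (hx : x ∈ A) (hxp : x ∉ p.dom) {c d : ℝ} (hcd : c < d) (hsub : Set.Ioo c d ⊆ p.gap x) :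
    ∃ q ∈ P, ∃ y ∈ Set.Ioo c d, q.graph = insert (x, y) p.graph := by
  classical
  obtain ⟨q, hq, hqp, y, hy, hxy⟩ := hP.denseMapping p hp x hx hxp c d hcd hsub
  have hqp : p.graph ⊆ q.graph := hqp
  refine ⟨q.restrict (insert x (p.graph.image Prod.fst)), hP.restriction q hq _ ?_, y, hy, ?_⟩
  · intro z hz
    rcases Finset.mem_insert.1 (Finset.mem_coe.1 hz) with rfl | hz
    · exact ⟨y, hxy⟩
    · obtain ⟨w, hw, rfl⟩ := Finset.mem_image.1 hz
      exact ⟨w.2, hqp hw⟩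
  · ext ⟨a, b⟩
    simp only [FinPartialIso.restrict, Finset.mem_filter, Finset.mem_insert, Finset.mem_image,
      Prod.mk.injEq]
    constructor
    · rintro ⟨hab, rfl | ⟨⟨a', b'⟩, hab', rfl⟩⟩
      · exact Or.inl ⟨rfl, q.snd_eq hab hxy⟩
      · rw [q.snd_eq hab (hqp hab')]
        exact Or.inr hab'
    · rintro (⟨rfl, rfl⟩ | h)
      · exact ⟨hxy, Or.inl rfl⟩
      · exact ⟨hqp h, Or.inr ⟨_, h, rfl⟩⟩

theorem exists_mem_dom (hP : IsReasonable P) {p : FinPartialIso A B} (hp : p ∈ P) {x : ℝ}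
    (hx : x ∈ A) : ∃ q ∈ P, q ≤ p ∧ ∃ y, (x, y) ∈ q.graph := by
  by_cases hxp : x ∈ p.dom
  · exact ⟨p, hp, le_rfl, hxp⟩
  · obtain ⟨c, d, hcd, hsub⟩ := p.exists_Ioo_subset_gap x
    obtain ⟨q, hq, hqp, y, -, hy⟩ := hP.denseMapping p hp x hx hxp c d hcd hsub
    exact ⟨q, hq, hqp, y, hy⟩

/-- Finitely many new points can be mapped into prescribed intervals inside the gaps of `p`. -/
theorem exists_extension_into (hP : IsReasonable P) {p : FinPartialIso A B} (hp : p ∈ P)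
    {u v : Finset (ℝ × ℝ) → ℝ} (huv : ∀ x ∉ p.dom, u (p.cut x) < v (p.cut x) ∧
      Set.Ioo (u (p.cut x)) (v (p.cut x)) ⊆ p.gap x)
    (W : Finset ℝ) (hW : ∀ w ∈ W, w ∈ A ∧ w ∉ p.dom) :
    ∃ q ∈ P, q ≤ p ∧ (∀ w ∈ W, w ∈ q.dom) ∧ ∀ z ∈ q.graph, z ∈ p.graph ∨
      z.1 ∉ p.dom ∧ z.2 ∈ Set.Ioo (u (p.cut z.1)) (v (p.cut z.1)) := by
  classical
  induction W using Finset.induction_on with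
  | empty => exact ⟨p, hp, le_rfl, by simp, fun z hz => Or.inl hz⟩
  | insert w W _ ih =>
    obtain ⟨q, hq, hqp, hWq, hqz⟩ := ih fun w hw => hW w (Finset.mem_insert_of_mem hw)
    obtain ⟨hwA, hwp⟩ := hW w (Finset.mem_insert_self _ _)
    by_cases hwq : w ∈ q.dom
    · refine ⟨q, hq, hqp, fun w' hw' => ?_, hqz⟩
      rcases Finset.mem_insert.1 hw' with rfl | hw'
      · exact hwq
      · exact hWq w' hw'
    obtain ⟨hlt, hgap⟩ := huv w hwp
    set U := u (p.cut w) with hU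
    set V := v (p.cut w) with hV
    have hUp : ∀ z ∈ p.graph, z.1 < w → z.2 ≤ U := fun z hz hzw => by
      by_contra! h
      obtain ⟨y, hy₁, hy₂⟩ := exists_between (lt_min h hlt)
      exact ((hgap ⟨hy₁, hy₂.trans_le (min_le_right _ _)⟩ z hz).1 hzw).not_gt
        (hy₂.trans_le (min_le_left _ _))
    have hVp : ∀ z ∈ p.graph, w < z.1 → V ≤ z.2 := fun z hz hzw => by
      by_contra! h
      obtain ⟨y, hy₁, hy₂⟩ := exists_between (max_lt h hlt)
      exact ((hgap ⟨(le_max_right _ _).trans_lt hy₁, hy₂⟩ z hz).2 hzw).not_gt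
        ((le_max_left _ _).trans_lt hy₁)
    -- Earlier new points in the gap of w have values in (U, V). Any other point of q below w is in
    -- dom p, or is separated from w by a point of dom p. So (U, V) still meets the gap of q at w.
    have hlow : ∀ z ∈ q.graph, z.1 < w → z.2 < V := fun z hz hzw => by
      rcases hqz z hz with hzp | ⟨hzp, hzI⟩
      · exact (hUp z hzp hzw).trans_lt hlt
      · by_cases hc : p.cut z.1 = p.cut w
        · rw [hc] at hzI
          exact hzI.2
        · obtain ⟨t, ht, htz, htw⟩ : ∃ t ∈ p.graph, z.1 < t.1 ∧ t.1 < w := by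
            by_contra! hno
            refine hc (Finset.filter_congr fun t ht => ⟨fun h => h.trans hzw, fun h => ?_⟩)
            rcases lt_trichotomy t.1 z.1 with h' | h' | h'
            · exact h'
            · exact (hzp ⟨t.2, h' ▸ ht⟩).elim
            · exact ((hno t ht h').not_gt h).elim
          exact ((q.lt_iff z hz t (hqp ht)).1 htz).trans ((hUp t ht htw).trans_lt hlt)
    have hupp : ∀ z ∈ q.graph, w < z.1 → U < z.2 := fun z hz hzw => by
      rcases hqz z hz with hzp | ⟨hzp, hzI⟩
      · exact hlt.trans_le (hVp z hzp hzw)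
      · by_cases hc : p.cut z.1 = p.cut w
        · rw [hc] at hzI
          exact hzI.1
        · obtain ⟨t, ht, htw, htz⟩ : ∃ t ∈ p.graph, w < t.1 ∧ t.1 < z.1 := by
            by_contra! hno
            refine hc (Finset.filter_congr fun t ht => ⟨fun h => ?_, fun h => h.trans hzw⟩)
            rcases lt_trichotomy t.1 w with h' | h' | h'
            · exact h'
            · exact (hwp ⟨t.2, h' ▸ ht⟩).elim
            · exact ((hno t ht h').not_gt h).elim
          exact (hlt.trans_le (hVp t ht htw)).trans ((q.lt_iff t (hqp ht) z hz).1 htz)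
    obtain ⟨c, d, hcd, H⟩ := exists_Ioo_between_finsets
      (insert U ((q.graph.filter fun z => z.1 < w).image Prod.snd))
      (insert V ((q.graph.filter fun z => w < z.1).image Prod.snd)) (by
        simp only [Finset.mem_insert, Finset.mem_image, Finset.mem_filter]
        rintro _ (rfl | ⟨z, ⟨hz, hzw⟩, rfl⟩) _ (rfl | ⟨t, ⟨ht, htw⟩, rfl⟩)
        · exact hlt
        · exact hupp t ht htw
        · exact hlow z hz hzw
        · exact (q.lt_iff z hz t ht).1 (hzw.trans htw))
    have hcdgap : Set.Ioo c d ⊆ q.gap w := fun y hy z hz =>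
      ⟨fun hzw => (H y hy).1 _ (Finset.mem_insert_of_mem
        (Finset.mem_image_of_mem _ (Finset.mem_filter.2 ⟨hz, hzw⟩))),
      fun hzw => (H y hy).2 _ (Finset.mem_insert_of_mem
        (Finset.mem_image_of_mem _ (Finset.mem_filter.2 ⟨hz, hzw⟩)))⟩
    obtain ⟨q', hq', y, hy, hgr⟩ := hP.exists_insert hq hwA hwq hcd hcdgap
    have hq'q : q' ≤ q := show q.graph ⊆ q'.graph from hgr ▸ Finset.subset_insert _ _
    refine ⟨q', hq', hq'q.trans hqp, fun w' hw' => ?_, fun z hz => ?_⟩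
    · rcases Finset.mem_insert.1 hw' with rfl | hw'
      · exact ⟨y, hgr ▸ Finset.mem_insert_self _ _⟩
      · obtain ⟨y', hy'⟩ := hWq w' hw'
        exact ⟨y', hq'q hy'⟩
    · rw [hgr] at hz
      rcases Finset.mem_insert.1 hz with rfl | hz
      · exact Or.inr ⟨hwp, (H y hy).1 _ (Finset.mem_insert_self _ _),
          (H y hy).2 _ (Finset.mem_insert_self _ _)⟩
      · exact hqz z hz

/-- If `K` is compact and misses `dom p`, then `p` can be extended so as to prevent the generic map
from taking points of `K` to points of a given closed nowhere dense set `S`. -/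
theorem exists_le_forall_notMem (hP : IsReasonable P) (hA : IsAleph1Dense A)
    {p : FinPartialIso A B} (hp : p ∈ P) {K S : Set ℝ} (hK : IsCompact K)
    (hKp : ∀ x ∈ K, x ∉ p.dom) (hS : IsClosed S) (hS' : interior S = ∅) :
    ∃ q ∈ P, q ≤ p ∧ ∀ t ≤ q, ∀ z ∈ t.graph, z.1 ∈ K → z.2 ∉ S := by
  classical
  obtain ⟨u, v, huv⟩ := p.exists_Ioo_cut hS hS'
  -- Endpoints come from A so that they can be added to the domain, and [c, d] misses dom p so that
  -- c and d lie in the same gap of p. Off K the values are irrelevant.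
  have hcov : ∀ x, ∃ c d, x ∈ K → c ∈ A ∧ d ∈ A ∧ x ∈ Set.Ioo c d ∧
      ∀ y ∈ Set.Icc c d, y ∉ p.dom := fun x => by
    by_cases hx : x ∈ K
    swap
    · exact ⟨0, 0, fun h => (hx h).elim⟩
    have hop : IsOpen ((p.graph.image Prod.fst : Finset ℝ) : Set ℝ)ᶜ :=
      (Finset.finite_toSet _).isClosed.isOpen_compl
    have hdom : ∀ y, y ∈ ((p.graph.image Prod.fst : Finset ℝ) : Set ℝ) ↔ y ∈ p.dom := fun y => by
      simp [FinPartialIso.dom]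
    obtain ⟨l, r, hlr, hsub⟩ := mem_nhds_iff_exists_Ioo_subset.1
      (hop.mem_nhds (fun h => hKp x hx ((hdom x).1 h)))
    obtain ⟨c, hc, hc'⟩ := hA.exists_mem_Ioo hlr.1
    obtain ⟨d, hd, hd'⟩ := hA.exists_mem_Ioo hlr.2
    exact ⟨c, d, fun _ => ⟨hc, hd, ⟨hc'.2, hd'.1⟩, fun y hy h =>
      hsub ⟨hc'.1.trans_le hy.1, hy.2.trans_lt hd'.2⟩ ((hdom y).2 h)⟩⟩
  choose c d hcov using hcov
  obtain ⟨s, hs, hsub⟩ := hK.elim_nhds_subcover (fun x => Set.Ioo (c x) (d x))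
    fun x hx => isOpen_Ioo.mem_nhds (hcov x hx).2.2.1
  have hends : ∀ x ∈ s, c x ∉ p.dom ∧ d x ∉ p.dom := fun x hx => by
    obtain ⟨-, -, h, h'⟩ := hcov x (hs x hx)
    have := (h.1.trans h.2).le
    exact ⟨h' _ ⟨le_rfl, this⟩, h' _ ⟨this, le_rfl⟩⟩
  obtain ⟨q, hq, hqp, hW, hqz⟩ := hP.exists_extension_into hp
    (fun x hx => ⟨(huv x hx).1, (huv x hx).2.1⟩) (s.image c ∪ s.image d) (by
      intro w hw
      rcases Finset.mem_union.1 hw with hw | hw <;> obtain ⟨x, hx, rfl⟩ := Finset.mem_image.1 hw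
      · exact ⟨(hcov x (hs x hx)).1, (hends x hx).1⟩
      · exact ⟨(hcov x (hs x hx)).2.1, (hends x hx).2⟩)
  refine ⟨q, hq, hqp, fun t htq z hz hzK => ?_⟩
  obtain ⟨x, hx, hzx⟩ := Set.mem_iUnion₂.1 (hsub hzK)
  obtain ⟨-, -, -, hno⟩ := hcov x (hs x hx)
  obtain ⟨hcp, hdp⟩ := hends x hx
  obtain ⟨y₁, hy₁⟩ := hW (c x) (Finset.mem_union_left _ (Finset.mem_image_of_mem _ hx))
  obtain ⟨y₂, hy₂⟩ := hW (d x) (Finset.mem_union_right _ (Finset.mem_image_of_mem _ hx))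
  have hcut : p.cut (d x) = p.cut (c x) := Finset.filter_congr fun w hw =>
    ⟨fun h => not_le.1 fun h' => hno w.1 ⟨h', h.le⟩ ⟨w.2, hw⟩,
      fun h => h.trans (hzx.1.trans hzx.2)⟩
  have h₁ := (hqz _ hy₁).resolve_left fun h => hcp ⟨_, h⟩
  have h₂ := (hqz _ hy₂).resolve_left fun h => hdp ⟨_, h⟩
  dsimp only at h₁ h₂
  rw [hcut] at h₂
  -- The value at z lies strictly between the values at the two endpoints, both in one interval
  -- disjoint from S.
  exact (huv _ hcp).2.2 ⟨h₁.2.1.trans ((t.lt_iff _ (htq hy₁) z hz).1 hzx.1),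
    ((t.lt_iff z hz _ (htq hy₂)).1 hzx.2).trans h₂.2.2⟩

end IsReasonable

/-- The conditions which force that the generic map takes no point of `digitSet n` to a point
of `digitSet n ∪ F n`. -/
def avoiding {A B : Set ℝ} (P : Set (FinPartialIso A B)) (F : ℕ → Finset ℝ) (n : ℕ) : Set P :=
  {p | ∀ q ≤ p, ∀ z ∈ q.1.graph, z.1 ∈ digitSet n → z.2 ∉ digitSet n ∪ F n}

theorem IsReasonable.exists_le_mem_avoiding {C : Set (Set ℕ)} (hC : IsTower C) (hne : C.Nonempty)
    {B : Set ℝ} (hA : IsAleph1Dense (codeSet C)) {P : Set (FinPartialIso (codeSet C) B)}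
    (hP : IsReasonable P) (F : ℕ → Finset ℝ) (k : ℕ) (p : P) :
    ∃ q ≤ p, ∃ n ≥ k, q ∈ avoiding P F n := by
  classical
  choose! Y hYC _ hY using fun x (hx : x ∈ codeSet C) =>
    eventually_mem_digitSet_of_mem_codeSet hx
  -- For large n lying in every set coded by a point of dom p, the domain misses `digitSet n`.
  have h₁ : ∃ᶠ n in Filter.atTop, ∀ Z ∈ p.1.graph.image (fun z => Y z.1), n ∈ Z :=
    hC.frequently_forall_mem hne fun Z hZ => by
      obtain ⟨z, hz, rfl⟩ := Finset.mem_image.1 (Finset.mem_coe.1 hZ)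
      exact hYC _ (p.1.fst_mem z hz)
  have h₂ : ∀ᶠ n in Filter.atTop, ∀ z ∈ p.1.graph, z.1 ∈ digitSet n ↔ n ∉ Y z.1 :=
    (Filter.eventually_all_finset _).2 fun z hz => hY z.1 (p.1.fst_mem z hz)
  obtain ⟨n, hn, hn₁, hn₂⟩ := Filter.frequently_atTop.1 (h₁.and_eventually h₂) k
  obtain ⟨q, hq, hqp, H⟩ := hP.exists_le_forall_notMem hA p.2 (isCompact_digitSet n)
    (fun x hx ⟨y, hy⟩ => (hn₂ _ hy).1 hx
      (hn₁ _ (Finset.mem_image_of_mem (fun z : ℝ × ℝ => Y z.1) hy)))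
    (S := digitSet n ∪ F n)
    ((isCompact_digitSet n).isClosed.union (Finset.finite_toSet _).isClosed)
    ((interior_union_isClosed_of_interior_empty (isCompact_digitSet n).isClosed
      (interior_eq_empty_iff_dense_compl.2 ((F n).countable_toSet.dense_compl ℝ))).trans (interior_digitSet n))
  exact ⟨⟨q, hq⟩, hqp, n, hn, fun t ht => H t.1 ht⟩

theorem IsReasonable.addsPseudointersection {T C : Set (Set ℕ)} (hC : IsTower C)
    (hne : C.Nonempty) (hcof : ∀ Y ∈ T, ∃ Z ∈ C, AlmostSubset Z Y)
    (hseg : ∀ Y ∈ C, {Z ∈ C | ¬ AlmostSubset Z Y}.Countable)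
    (hA : IsAleph1Dense (codeSet C)) {P : Set (FinPartialIso (codeSet C) (codeSet C))}
    (hP : IsReasonable P) : AddsPseudointersection P T := by
  classical
  refine setLang.addsPseudointersection_of_dense fun p => ?_
  suffices h : ∃ q ≤ p, ∃ F : ℕ → Finset ℝ, ∀ Y ∈ C, ∀ r ≤ q, ∃ s ≤ r, ∃ z ∈ s.1.graph,
      (∀ᶠ n in Filter.atTop, n ∉ Y → z.1 ∈ digitSet n) ∧
      ∀ᶠ n in Filter.atTop, n ∉ Y → z.2 ∈ digitSet n ∪ F n by
    obtain ⟨q, hqp, F, hF⟩ := h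
    refine ⟨q, hqp, avoiding P F,
      fun k r _ => hP.exists_le_mem_avoiding hC hne hA F k r, fun Y hY r hr => ?_⟩
    obtain ⟨Y', hY', hYY'⟩ := hcof Y hY
    obtain ⟨s, hs, z, hz, h₁, h₂⟩ := hF Y' hY' r hr
    obtain ⟨k, hk⟩ := Filter.eventually_atTop.1 (h₁.and (h₂.and hYY'.eventually))
    refine ⟨s, hs, k, fun n hn t ht ⟨d, hd, htd⟩ => ?_⟩
    obtain ⟨h₁, h₂, h₃⟩ := hk n hn
    by_contra hnY
    have hnY' : n ∉ Y' := fun h => hnY (h₃ h)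
    -- For large n ∉ Y the pair z itself is one that a condition in `avoiding P F n` forbids.
    exact hd t htd z (ht hz) (h₁ hnY') (h₂ hnY')
  have hev : ∀ {X Y : Set ℕ} {x : ℝ}, (∀ᶠ n in Filter.atTop, x ∈ digitSet n ↔ n ∉ X) →
      AlmostSubset X Y → ∀ᶠ n in Filter.atTop, n ∉ Y → x ∈ digitSet n := by
    intro X Y x hx hXY
    filter_upwards [hx, hXY.eventually] with n h₁ h₂ hn
    exact h₁.2 fun h => hn (h₂ h)
  -- The dichotomy that decides whether F is needed: do pairs with both coordinates coding sets ⊆* Y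
  -- occur densely below p, for every Y ∈ C?
  by_cases hcase : ∀ q ≤ p, ∀ Y ∈ C, ∃ r ≤ q, ∃ z ∈ r.1.graph,
      (∃ X, AlmostSubset X Y ∧ ∀ᶠ n in Filter.atTop, z.1 ∈ digitSet n ↔ n ∉ X) ∧
      ∃ X, AlmostSubset X Y ∧ ∀ᶠ n in Filter.atTop, z.2 ∈ digitSet n ↔ n ∉ X
  · refine ⟨p, le_rfl, fun _ => ∅, fun Y hY r hr => ?_⟩
    obtain ⟨s, hs, z, hz, ⟨X, hX, hzX⟩, X', hX', hzX'⟩ := hcase r hr Y hY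
    exact ⟨s, hs, z, hz, hev hzX hX, (hev hzX' hX').mono fun n h hn => Or.inl (h hn)⟩
  · simp only [not_forall] at hcase
    obtain ⟨q, hqp, Y₀, hY₀, hno⟩ := hcase
    -- Each F n is finite, so `digitSet n ∪ F n` stays closed and nowhere dense, yet every point of
    -- the countable set is eventually in F n.
    obtain ⟨F, hF⟩ : ∃ F : ℕ → Finset ℝ, ∀ x ∈ codeSet {Z ∈ C | ¬ AlmostSubset Z Y₀},
        ∀ᶠ n in Filter.atTop, x ∈ F n := by
      rcases (codeSet {Z ∈ C | ¬ AlmostSubset Z Y₀}).eq_empty_or_nonempty with he | hne'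
      · exact ⟨fun _ => ∅, by simp [he]⟩
      · obtain ⟨e, he⟩ := (countable_codeSet (hseg Y₀ hY₀)).exists_eq_range hne'
        refine ⟨fun n => (Finset.range n).image e, fun x hx => ?_⟩
        rw [he] at hx
        obtain ⟨i, rfl⟩ := hx
        filter_upwards [Filter.eventually_gt_atTop i] with n hn
        exact Finset.mem_image_of_mem _ (Finset.mem_range.2 hn)
    refine ⟨q, hqp, F, fun Y hY r hr => ?_⟩
    -- X is the ⊆*-smaller of Y and Y₀: a code of X serves Y as first coordinate, and by the choice
    -- of q its image must code a set not ⊆* Y₀.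
    obtain ⟨X, hX, hXY, hXY₀⟩ : ∃ X ∈ C, AlmostSubset X Y ∧ AlmostSubset X Y₀ := by
      rcases hC.total hY hY₀ with h | h
      · exact ⟨Y, hY, AlmostSubset.refl _, h⟩
      · exact ⟨Y₀, hY₀, h, AlmostSubset.refl _⟩
    obtain ⟨x, hx, -⟩ := exists_mem_codeSet_Ioo (Set.singleton_nonempty X) (zero_lt_one' ℝ)
    obtain ⟨X', rfl, -, hxX⟩ := eventually_mem_digitSet_of_mem_codeSet hx
    obtain ⟨c, d, h, rfl⟩ : ∃ c d : ℚ, (c : ℝ) < d ∧ code X' c d = x := by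
      obtain ⟨_, rfl, h⟩ := hx
      exact h
    obtain ⟨s, hs, hsr, y, hy⟩ := hP.exists_mem_dom r.2 (x := code X' c d) ⟨X', hX, c, d, h, rfl⟩
    refine ⟨⟨s, hs⟩, hsr, _, hy, hev hxX hXY, ?_⟩
    obtain ⟨Z, hZ, hyZ, hyev⟩ := eventually_mem_digitSet_of_mem_codeSet (s.snd_mem _ hy)
    have hZY₀ : ¬ AlmostSubset Z Y₀ := fun hZY₀ =>
      hno ⟨⟨s, hs⟩, le_trans hsr hr, _, hy, ⟨X', hXY₀, hxX⟩, Z, hZY₀, hyev⟩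
    obtain ⟨_, rfl, h'⟩ := hyZ
    exact (hF y ⟨_, ⟨hZ, hZY₀⟩, h'⟩).mono fun n hn _ => Or.inr hn

theorem theorem2p1 (T : Set (Set ℕ)) (hT : IsTower T) (hcard : #(↥T) = ℵ₁) :
    ∃ A B : Set ℝ, IsAleph1Dense A ∧ IsAleph1Dense B ∧
      ∀ P : Set (FinPartialIso A B), IsReasonable P → AddsPseudointersection (↥P) T := by
  obtain ⟨C, hCT, hcof, hseg⟩ := hT.exists_cofinal hcard
  by_cases hc : C.Countable
  · obtain ⟨Z, hZ, hZC⟩ := (hT.mono hCT).exists_pseudointersection hc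
    -- Here `D n` consists of all conditions or of none, so the name denotes the ground model set Z.
    -- The poset plays no role.
    refine ⟨codeSet T, codeSet T, hT.isAleph1Dense_codeSet hcard, hT.isAleph1Dense_codeSet hcard,
      fun P _ => setLang.addsPseudointersection_of_dense fun p =>
        ⟨p, le_rfl, fun n => {_q | n ∈ Z}, fun k r _ => ?_, fun Y hY r _ => ?_⟩⟩
    · obtain ⟨n, hn, hk⟩ := hZ.exists_gt k
      exact ⟨r, le_rfl, n, hk.le, hn⟩
    · obtain ⟨X, hX, hXY⟩ := hcof Y hY
      obtain ⟨k, hk⟩ := Filter.eventually_atTop.1 ((hZC X hX).trans hXY).eventually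
      exact ⟨r, le_rfl, k, fun n hn t _ ⟨_, hd, _⟩ => hk n hn hd⟩
  · have hcardC : #C = ℵ₁ := by
      refine le_antisymm (hcard ▸ Cardinal.mk_le_mk_of_subset hCT) ?_
      rw [Cardinal.aleph_one_le_iff, Cardinal.aleph0_lt_mk_iff]
      exact not_countable_iff.1 hc
    have hC := hT.mono hCT
    have hA := hC.isAleph1Dense_codeSet hcardC
    have hne : C.Nonempty := Set.nonempty_iff_ne_empty.2 fun h => hc (h ▸ Set.countable_empty)
    exact ⟨_, _, hA, hA, fun P hP => hP.addsPseudointersection hC hne hcof hseg hA⟩
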